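/- For $x\in\mathbb{R}$ and $k\in\mathbb{N}_0$ let $(x)_k = x(x+1)\cdots(x+k-1)$, and for real $s$ let $(x)_s = \Gamma(x+s)/\Gamma(x)$, where $1/\Gamma$ is the entire reciprocal Gamma function, equal to $0$ at $0,-1,-2,\ldots$. Let $a$, $b$, $n$ be real numbers such that none of $b$, $a/2$, $1+a+n$ belongs to $\{0,-1,-2,\ldots\}$, and such that either $a < 2(b+n)$, or at least one of $a$, $-n$, $a-b+1$ belongs to $\{0,-1,-2,\ldots\}$ (so that the series below terminates). Then the series $$ {}_4F_3\!\left[\begin{matrix} a,\ -n,\ \frac a2+1,\ a-b+1\\ b,\ \frac a2,\ 1+a+n\end{matrix}\,;\,-1\right] = \sum_{k=0}^{\infty} \frac{(a)_k\,(-n)_k\,(\frac a2+1)_k\,(a-b+1)_k}{(b)_k\,(\frac a2)_k\,(1+a+n)_k}\,\frac{(-1)^k}{k!} $$ converges (possibly only conditionally, as the limit of its partial sums), and its value is $$ \frac{(a+1)_n}{(b)_n} = \frac{\Gamma(a+1+n)\,\Gamma(b)}{\Gamma(a+1)\,\Gamma(b+n)}, $$ which is read as $0$ when $b+n\in\{0,-1,-2,\ldots\}$.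 -/

import Mathlib

open Filter Topology

noncomputable section

/-- The Pochhammer symbol `(x)_k = x (x + 1) ⋯ (x + k - 1)` of a real number, `k ∈ ℕ`. -/
def poch (x : ℝ) (k : ℕ) : ℝ := (ascPochhammer ℝ k).eval x

/-- The Pochhammer symbol `(x)_s = Γ(x + s) / Γ(x)` for a real index `s`.
(`Real.Gamma` takes the value `0` at its poles, so that `(Real.Gamma x)⁻¹` is the entire
reciprocal Gamma function, which vanishes exactly at `0, -1, -2, …`.) -/
def pochReal (x s : ℝ) : ℝ := Real.Gamma (x + s) / Real.Gamma x

/-- The `k`-th term of the generalized hypergeometric series with upper parameters `as`,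
lower parameters `bs` and argument `x`. -/
def hypTerm (as bs : List ℝ) (x : ℝ) (k : ℕ) : ℝ :=
  (as.map fun α => poch α k).prod / (bs.map fun β => poch β k).prod *
    (x ^ k / (Nat.factorial k : ℝ))

/-- The generalized hypergeometric series converges, as the limit of its partial sums
(possibly only conditionally), and has the value `v`. -/
def HasHypSum (as bs : List ℝ) (x v : ℝ) : Prop :=
  Tendsto (fun N : ℕ => ∑ k ∈ Finset.range N, hypTerm as bs x k) atTop (𝓝 v)

end

/-! With `c = -n`, `d = a - b + 1`, the series is `a⁻¹ ∑ (a + 2k) t_k`, where `t_k = wpTerm a c d k`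
is well-poised. A telescoping identity (`wpTerm_telescope`) relates the partial sums at `a` and `a +
1` up to a boundary term `N t_N`. The claimed Gamma quotient obeys the same recurrence.

For large `a`, iterating gives a Pochhammer quotient times the sum at `a + M`. Dominated convergence
sends the latter, divided by `a + M`, to `1`, and Gamma asymptotics give the value
(`wpSum_of_large`). Any other `a` is reached by descending from `a + M`: only the boundary terms
must vanish, so conditional convergence needs no separate argument. If `a = -m`, the descent starts
at `a = 0` instead. -/

theorem poch_zero (x : ℝ) : poch x 0 = 1 := by simp [poch]

theorem poch_succ (x : ℝ) (k : ℕ) : poch x (k + 1) = poch x k * (x + k) := by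
  simp [poch, ascPochhammer_succ_eval]

theorem mul_poch_add_one (x : ℝ) (k : ℕ) : x * poch (x + 1) k = poch x k * (x + k) := by
  induction k with
  | zero => simp [poch_zero]
  | succ k ih =>
    rw [poch_succ, poch_succ, ← mul_assoc, ih]
    push_cast
    ring

theorem poch_ne_zero {x : ℝ} (hx : ∀ k : ℕ, x ≠ -(k : ℝ)) (k : ℕ) : poch x k ≠ 0 := by
  induction k with
  | zero => simp [poch_zero]
  | succ k ih =>
    rw [poch_succ]
    exact mul_ne_zero ih fun h => hx k (by linarith)

theorem poch_neg_natCast_eq_zero {m k : ℕ} (h : m < k) : poch (-(m : ℝ)) k = 0 := by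
  induction k with
  | zero => omega
  | succ k ih =>
    rw [poch_succ]
    rcases Nat.lt_succ_iff_lt_or_eq.mp h with h | rfl
    · rw [ih h, zero_mul]
    · simp

theorem poch_eq_prod (x : ℝ) (k : ℕ) : poch x k = ∏ j ∈ Finset.range k, (x + j) := by
  induction k with
  | zero => simp [poch_zero]
  | succ k ih => rw [poch_succ, ih, Finset.prod_range_succ]

theorem add_natCast_ne {x : ℝ} (hx : ∀ k : ℕ, x ≠ -(k : ℝ)) (m k : ℕ) :
    x + m ≠ -(k : ℝ) := fun h => hx (k + m) (by push_cast; linarith)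

/-! ### Reciprocal Gamma function and Pochhammer asymptotics -/

theorem inv_Gamma_eq (x : ℝ) : (Real.Gamma x)⁻¹ = x * (Real.Gamma (x + 1))⁻¹ := by
  by_cases hx : x = 0
  · simp [hx, Real.Gamma_zero]
  · rw [Real.Gamma_add_one hx, mul_inv, mul_inv_cancel_left₀ hx]

theorem inv_GammaSeq_tendsto (x : ℝ) :
    Tendsto (fun k => (Real.GammaSeq x k)⁻¹) atTop (𝓝 (Real.Gamma x)⁻¹) := by
  by_cases hx : ∃ m : ℕ, x = -(m : ℝ)
  · obtain ⟨m, rfl⟩ := hx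
    rw [Real.Gamma_neg_nat_eq_zero, inv_zero]
    -- Once `k ≥ m`, the product in the denominator of `GammaSeq` contains a zero factor; division
    -- by zero then makes its inverse `0`.
    refine tendsto_const_nhds.congr' ?_
    filter_upwards [eventually_ge_atTop m] with k hk
    have : poch (-(m : ℝ)) (k + 1) = 0 := poch_neg_natCast_eq_zero (by omega)
    rw [Real.GammaSeq, ← poch_eq_prod, this]
    simp
  · push Not at hx
    exact (Real.GammaSeq_tendsto_Gamma x).inv₀ (Real.Gamma_ne_zero hx)

/-- `(x)_k ∼ k! k ^ (x - 1) / Γ(x)`. -/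
theorem poch_div_tendsto (x : ℝ) :
    Tendsto (fun k : ℕ => poch x k / ((k.factorial : ℝ) * (k : ℝ) ^ (x - 1))) atTop
      (𝓝 (Real.Gamma x)⁻¹) := by
  have h1 : Tendsto (fun k : ℕ => (k : ℝ) / (k + x)) atTop (𝓝 1) :=
    tendsto_natCast_div_add_atTop x
  have h2 := (inv_GammaSeq_tendsto x).mul h1
  rw [mul_one] at h2
  refine h2.congr' ?_
  filter_upwards [eventually_gt_atTop 0,
    (tendsto_natCast_atTop_atTop (R := ℝ)).eventually_gt_atTop (-x)] with k hk hkx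
  have hk' : (0 : ℝ) < k := by exact_mod_cast hk
  have h3 : (k : ℝ) + x ≠ 0 := by linarith
  have h4 : (k : ℝ) ^ x ≠ 0 := (Real.rpow_pos_of_pos hk' x).ne'
  have h5 : (k.factorial : ℝ) ≠ 0 := by positivity
  rw [Real.GammaSeq, ← poch_eq_prod, poch_succ, Real.rpow_sub hk', Real.rpow_one]
  rw [add_comm] at h3
  rw [add_comm (k : ℝ) x]
  field_simp

/-! ### Well-poised terms and the contiguous relation in `a` -/

/-- The `k`-th term of the well-poised series with parameters `a, c, d` at `-1`. -/
noncomputable def wpTerm (a c d : ℝ) (k : ℕ) : ℝ :=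
  poch a k * poch c k * poch d k / (k.factorial * poch (1 + a - c) k * poch (1 + a - d) k) *
    (-1) ^ k

theorem wpTerm_zero (a c d : ℝ) : wpTerm a c d 0 = 1 := by simp [wpTerm, poch_zero]

theorem wpTerm_succ {a c d : ℝ} (hA : ∀ k : ℕ, 1 + a - c ≠ -(k : ℝ))
    (hB : ∀ k : ℕ, 1 + a - d ≠ -(k : ℝ)) (k : ℕ) :
    (k + 1) * wpTerm a c d (k + 1) =
      -((a + k) * (c + k) * (d + k)) / ((1 + a - c + k) * (1 + a - d + k)) * wpTerm a c d k := by
  have h1 := poch_ne_zero hA k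
  have h2 := poch_ne_zero hB k
  have h3 : 1 + a - c + k ≠ 0 := fun h => hA k (by linarith)
  have h4 : 1 + a - d + k ≠ 0 := fun h => hB k (by linarith)
  have h5 : (k.factorial : ℝ) ≠ 0 := by positivity
  have h6 : (k : ℝ) + 1 ≠ 0 := by positivity
  simp only [wpTerm, poch_succ, Nat.factorial_succ, pow_succ]
  push_cast
  field_simp

theorem mul_wpTerm_add_one {a c d : ℝ} (hA : ∀ k : ℕ, 1 + a - c ≠ -(k : ℝ))
    (hB : ∀ k : ℕ, 1 + a - d ≠ -(k : ℝ)) (k : ℕ) :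
    a * wpTerm (a + 1) c d k =
      (a + k) * (1 + a - c) * (1 + a - d) / ((1 + a - c + k) * (1 + a - d + k)) *
        wpTerm a c d k := by
  have h1 := poch_ne_zero hA k
  have h2 := poch_ne_zero hB k
  have h3 : 1 + a - c + k ≠ 0 := fun h => hA k (by linarith)
  have h4 : 1 + a - d + k ≠ 0 := fun h => hB k (by linarith)
  have h5 : (k.factorial : ℝ) ≠ 0 := by positivity
  have h6 : 1 + a - c ≠ 0 := fun h => hA 0 (by simpa using h)
  have h7 : 1 + a - d ≠ 0 := fun h => hB 0 (by simpa using h)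
  have e1 := mul_poch_add_one (1 + a - c) k
  have e2 := mul_poch_add_one (1 + a - d) k
  have e3 := mul_poch_add_one a k
  have e1' : poch (1 + (a + 1) - c) k = poch (1 + a - c) k * (1 + a - c + k) / (1 + a - c) := by
    rw [← e1, mul_div_cancel_left₀ _ h6]; congr 1; ring
  have e2' : poch (1 + (a + 1) - d) k = poch (1 + a - d) k * (1 + a - d + k) / (1 + a - d) := by
    rw [← e2, mul_div_cancel_left₀ _ h7]; congr 1; ring
  simp only [wpTerm, e1', e2']
  field_simp
  linear_combination poch c k * poch d k * e3

/-- Both `wpTerm (a + 1) c d k` and `wpTerm a c d (k + 1)` are rational multiples of `wpTerm a c d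
k`, so this is an identity of rational functions with certificate `k t_k`. -/
theorem wpTerm_telescope {a c d : ℝ} (hA : ∀ k : ℕ, 1 + a - c ≠ -(k : ℝ))
    (hB : ∀ k : ℕ, 1 + a - d ≠ -(k : ℝ)) (k : ℕ) :
    (a + 2 * k) * wpTerm a c d k =
      a * (1 + a - c - d) / ((1 + a - c) * (1 + a - d)) *
        ((a + 1 + 2 * k) * wpTerm (a + 1) c d k) -
      (((k + 1 : ℕ) : ℝ) * wpTerm a c d (k + 1) - (k : ℝ) * wpTerm a c d k) := by
  have h3 : 1 + a - c + k ≠ 0 := fun h => hA k (by linarith)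
  have h4 : 1 + a - d + k ≠ 0 := fun h => hB k (by linarith)
  have h6 : 1 + a - c ≠ 0 := fun h => hA 0 (by simpa using h)
  have h7 : 1 + a - d ≠ 0 := fun h => hB 0 (by simpa using h)
  have e : a * (1 + a - c - d) / ((1 + a - c) * (1 + a - d)) *
        ((a + 1 + 2 * k) * wpTerm (a + 1) c d k) =
      (1 + a - c - d) / ((1 + a - c) * (1 + a - d)) * (a + 1 + 2 * k) *
        (a * wpTerm (a + 1) c d k) := by ring
  rw [e, mul_wpTerm_add_one hA hB]
  push_cast
  rw [wpTerm_succ hA hB]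
  field_simp
  ring

theorem sum_wpTerm {a c d : ℝ} (hA : ∀ k : ℕ, 1 + a - c ≠ -(k : ℝ))
    (hB : ∀ k : ℕ, 1 + a - d ≠ -(k : ℝ)) (N : ℕ) :
    ∑ k ∈ Finset.range N, (a + 2 * k) * wpTerm a c d k =
      a * (1 + a - c - d) / ((1 + a - c) * (1 + a - d)) *
        ∑ k ∈ Finset.range N, (a + 1 + 2 * k) * wpTerm (a + 1) c d k -
      N * wpTerm a c d N := by
  have h := Finset.sum_range_sub (fun k : ℕ => (k : ℝ) * wpTerm a c d k) N
  rw [Finset.sum_congr rfl fun k _ => wpTerm_telescope hA hB k, Finset.sum_sub_distrib, h,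
    Finset.mul_sum]
  simp

/-! ### Growth of the terms in `k` -/

theorem wpTerm_div_rpow_tendsto {a c d : ℝ} (hA : ∀ k : ℕ, 1 + a - c ≠ -(k : ℝ))
    (hB : ∀ k : ℕ, 1 + a - d ≠ -(k : ℝ)) :
    Tendsto (fun k : ℕ => |wpTerm a c d k| / (k : ℝ) ^ (2 * c + 2 * d - a - 3)) atTop
      (𝓝 |(Real.Gamma a)⁻¹ * (Real.Gamma c)⁻¹ * (Real.Gamma d)⁻¹ *
        Real.Gamma (1 + a - c) * Real.Gamma (1 + a - d)|) := by
  have hA' := (poch_div_tendsto (1 + a - c)).inv₀ (inv_ne_zero (Real.Gamma_ne_zero hA))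
  have hB' := (poch_div_tendsto (1 + a - d)).inv₀ (inv_ne_zero (Real.Gamma_ne_zero hB))
  rw [inv_inv] at hA' hB'
  have h := (((((poch_div_tendsto a).mul (poch_div_tendsto c)).mul (poch_div_tendsto d)).mul
    hA').mul hB').abs
  refine h.congr' ?_
  filter_upwards [eventually_gt_atTop 0] with k hk
  have hk' : (0 : ℝ) < k := by exact_mod_cast hk
  have h1 := poch_ne_zero hA k
  have h2 := poch_ne_zero hB k
  have h5 : (k.factorial : ℝ) ≠ 0 := by positivity
  have hp := Real.rpow_pos_of_pos hk' (2 * c + 2 * d - a - 3)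
  have e : (k : ℝ) ^ (2 * c + 2 * d - a - 3) =
      (k : ℝ) ^ (a - 1) * (k : ℝ) ^ (c - 1) * (k : ℝ) ^ (d - 1) /
        ((k : ℝ) ^ (1 + a - c - 1) * (k : ℝ) ^ (1 + a - d - 1)) := by
    rw [← Real.rpow_add hk', ← Real.rpow_add hk', ← Real.rpow_add hk', ← Real.rpow_sub hk']
    congr 1; ring
  rw [wpTerm, abs_mul _ ((-1 : ℝ) ^ k), abs_neg_one_pow, mul_one]
  rw [← abs_of_pos hp, ← abs_div, e]
  congr 1
  have q1 := (Real.rpow_pos_of_pos hk' (a - 1)).ne'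
  have q2 := (Real.rpow_pos_of_pos hk' (c - 1)).ne'
  have q3 := (Real.rpow_pos_of_pos hk' (d - 1)).ne'
  have q4 := (Real.rpow_pos_of_pos hk' (1 + a - c - 1)).ne'
  have q5 := (Real.rpow_pos_of_pos hk' (1 + a - d - 1)).ne'
  generalize (k : ℝ) ^ (a - 1) = x1 at *
  generalize (k : ℝ) ^ (c - 1) = x2 at *
  generalize (k : ℝ) ^ (d - 1) = x3 at *
  generalize (k : ℝ) ^ (1 + a - c - 1) = x4 at *
  generalize (k : ℝ) ^ (1 + a - d - 1) = x5 at *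
  field_simp

theorem wpTerm_isBigO {a c d : ℝ} (hA : ∀ k : ℕ, 1 + a - c ≠ -(k : ℝ))
    (hB : ∀ k : ℕ, 1 + a - d ≠ -(k : ℝ)) :
    wpTerm a c d =O[atTop] fun k : ℕ => (k : ℝ) ^ (2 * c + 2 * d - a - 3) := by
  refine Asymptotics.IsBigO.of_norm_left ?_
  refine Asymptotics.isBigO_of_div_tendsto_nhds ?_ _ (wpTerm_div_rpow_tendsto hA hB)
  filter_upwards [eventually_gt_atTop 0] with k hk h0
  have hk' : (0 : ℝ) < k := by exact_mod_cast hk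
  exact absurd h0 (Real.rpow_pos_of_pos hk' _).ne'

theorem natCast_mul_wpTerm_isBigO {a c d : ℝ} (hA : ∀ k : ℕ, 1 + a - c ≠ -(k : ℝ))
    (hB : ∀ k : ℕ, 1 + a - d ≠ -(k : ℝ)) :
    (fun k : ℕ => (k : ℝ) * wpTerm a c d k) =O[atTop]
      fun k : ℕ => (k : ℝ) ^ (2 * c + 2 * d - a - 2) := by
  refine ((Asymptotics.isBigO_refl (fun k : ℕ => (k : ℝ)) atTop).mul
    (wpTerm_isBigO hA hB)).congr' .rfl ?_
  filter_upwards [eventually_gt_atTop 0] with k hk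
  have hk' : (0 : ℝ) < k := by exact_mod_cast hk
  nth_rw 1 [← Real.rpow_one (k : ℝ)]
  rw [← Real.rpow_add hk']
  congr 1; ring

theorem natCast_mul_wpTerm_tendsto {a c d : ℝ} (hA : ∀ k : ℕ, 1 + a - c ≠ -(k : ℝ))
    (hB : ∀ k : ℕ, 1 + a - d ≠ -(k : ℝ)) (h : 2 * c + 2 * d < a + 2) :
    Tendsto (fun k : ℕ => (k : ℝ) * wpTerm a c d k) atTop (𝓝 0) := by
  refine (natCast_mul_wpTerm_isBigO hA hB).trans_tendsto ?_
  have := (tendsto_rpow_neg_atTop (y := a + 2 - 2 * c - 2 * d) (by linarith)).comp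
    (tendsto_natCast_atTop_atTop (R := ℝ))
  refine this.congr fun k => ?_
  simp only [Function.comp]
  congr 1; ring

theorem summable_wpTerm {a c d : ℝ} (hA : ∀ k : ℕ, 1 + a - c ≠ -(k : ℝ))
    (hB : ∀ k : ℕ, 1 + a - d ≠ -(k : ℝ)) (h : 2 * c + 2 * d < a + 1) :
    Summable fun k : ℕ => (a + 2 * k) * wpTerm a c d k := by
  have hs : Summable fun k : ℕ => (k : ℝ) ^ (2 * c + 2 * d - a - 2) :=
    Real.summable_nat_rpow.mpr (by linarith)
  have hs' : Summable fun k : ℕ => (k : ℝ) ^ (2 * c + 2 * d - a - 3) :=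
    Real.summable_nat_rpow.mpr (by linarith)
  have h1 := summable_of_isBigO_nat hs (natCast_mul_wpTerm_isBigO hA hB)
  have h2 := summable_of_isBigO_nat hs' (wpTerm_isBigO hA hB)
  refine ((h2.mul_left a).add (h1.mul_left 2)).congr fun k => ?_
  ring

/-! ### The limit `a → ∞` -/

theorem wpTerm_add_one_abs_le {a c d : ℝ} (h : 2 + 2 * |c| + 2 * |d| ≤ a) (k : ℕ) :
    |wpTerm (a + 1) c d k| ≤ |wpTerm a c d k| := by
  have hc := le_abs_self c
  have hd := le_abs_self d
  have hc' := neg_abs_le c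
  have hd' := neg_abs_le d
  have hc0 := abs_nonneg c
  have hd0 := abs_nonneg d
  have ha : 0 < a := by linarith
  have hA : 0 < 1 + a - c := by linarith
  have hB : 0 < 1 + a - d := by linarith
  have hk : (0 : ℝ) ≤ k := k.cast_nonneg
  have e := mul_wpTerm_add_one (a := a) (c := c) (d := d)
    (fun k => by have : (0 : ℝ) ≤ k := k.cast_nonneg
                 linarith)
    (fun k => by have : (0 : ℝ) ≤ k := k.cast_nonneg
                 linarith) k
  have hF : (a + k) * (1 + a - c) * (1 + a - d) / ((1 + a - c + k) * (1 + a - d + k)) ≤ a := by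
    rw [div_le_iff₀ (by positivity)]
    have h1 : (1 - c) * (1 - d) ≤ a ^ 2 := by
      have : |(1 - c) * (1 - d)| ≤ a * a := by
        rw [abs_mul]
        refine mul_le_mul ?_ ?_ (abs_nonneg _) ha.le
        · exact abs_le.mpr ⟨by linarith, by linarith⟩
        · exact abs_le.mpr ⟨by linarith, by linarith⟩
      calc _ ≤ _ := le_abs_self _
        _ ≤ _ := this
        _ = _ := by ring
    -- After clearing denominators, the difference of the two sides is `k (a² - (1 - c)(1 - d)) + a
    -- k²`.
    nlinarith [mul_nonneg hk (sub_nonneg.mpr h1), mul_nonneg ha.le (mul_nonneg hk hk)]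
  have hF0 : 0 ≤ (a + k) * (1 + a - c) * (1 + a - d) / ((1 + a - c + k) * (1 + a - d + k)) := by
    positivity
  have e' := congrArg abs e
  rw [abs_mul, abs_mul, abs_of_pos ha, abs_of_nonneg hF0] at e'
  refine le_of_mul_le_mul_left ?_ ha
  rw [e']
  exact mul_le_mul_of_nonneg_right hF (abs_nonneg _)

/-- Supplies the dominating series, uniform in `M`: both `(a + 2k) / a` and the absolute term
decrease under `a ↦ a + 1`. -/
theorem normalized_wpTerm_abs_le {a c d : ℝ} (h : 2 + 2 * |c| + 2 * |d| ≤ a) (k M : ℕ) :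
    |(a + M + 2 * k) / (a + M) * wpTerm (a + M) c d k| ≤
      |(a + 2 * k) / a * wpTerm a c d k| := by
  have hc0 := abs_nonneg c
  have hd0 := abs_nonneg d
  have hk : (0 : ℝ) ≤ k := k.cast_nonneg
  induction M with
  | zero => simp
  | succ M ih =>
    refine le_trans ?_ ih
    have hM : (0 : ℝ) ≤ M := M.cast_nonneg
    have hx : 0 < a + M := by linarith
    have e : a + ((M + 1 : ℕ) : ℝ) = a + M + 1 := by push_cast; ring
    rw [e, abs_mul, abs_mul]
    refine mul_le_mul ?_ (wpTerm_add_one_abs_le (by linarith) k) (abs_nonneg _) (abs_nonneg _)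
    rw [abs_of_nonneg (by positivity), abs_of_nonneg (by positivity),
      div_le_div_iff₀ (by positivity) (by positivity)]
    nlinarith

theorem wpTerm_ratio_tendsto_zero (p q : ℝ) :
    Tendsto (fun y : ℝ => y / ((y + p) * (y + q))) atTop (𝓝 0) := by
  have h (r : ℝ) : Tendsto (fun y : ℝ => (y + r)⁻¹) atTop (𝓝 0) :=
    tendsto_inv_atTop_zero.comp (tendsto_atTop_add_const_right _ _ tendsto_id)
  have h1 := (((h p).const_mul p).const_sub 1).mul (h q)
  rw [mul_zero] at h1
  refine h1.congr' ?_
  filter_upwards [eventually_gt_atTop (-p), eventually_gt_atTop (-q)] with y hp hq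
  have : y + p ≠ 0 := by linarith
  have : y + q ≠ 0 := by linarith
  field_simp
  ring

/-- Each ratio of consecutive terms is `O(1 / M)`, so only the term `k = 0` survives. -/
theorem wpTerm_tendsto_of_add_natCast {a c d : ℝ} (hA : ∀ k : ℕ, 1 + a - c ≠ -(k : ℝ))
    (hB : ∀ k : ℕ, 1 + a - d ≠ -(k : ℝ)) (k : ℕ) :
    Tendsto (fun M : ℕ => wpTerm (a + M) c d k) atTop (𝓝 (if k = 0 then 1 else 0)) := by
  induction k with
  | zero => simp [wpTerm_zero]
  | succ k ih =>
    have hy : Tendsto (fun M : ℕ => a + (M : ℝ) + k) atTop atTop :=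
      tendsto_atTop_add_const_right _ _
        (tendsto_atTop_add_const_left _ _ tendsto_natCast_atTop_atTop)
    have h1 := ((wpTerm_ratio_tendsto_zero (1 - c) (1 - d)).comp hy).const_mul
      (-((c + k) * (d + k)) / (k + 1))
    have h2 := h1.mul ih
    simp only [mul_zero, zero_mul] at h2
    simp only [Nat.add_eq_zero_iff, one_ne_zero, and_false, if_false]
    refine h2.congr fun M => ?_
    have hA' (j : ℕ) : 1 + (a + M) - c ≠ -(j : ℝ) := fun h => add_natCast_ne hA M j (by linarith)
    have hB' (j : ℕ) : 1 + (a + M) - d ≠ -(j : ℝ) := fun h => add_natCast_ne hB M j (by linarith)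
    have hs := wpTerm_succ hA' hB' k
    have hk : (k : ℝ) + 1 ≠ 0 := by positivity
    rw [mul_comm, ← eq_div_iff hk] at hs
    rw [hs]
    simp only [Function.comp]
    have e1 : a + M + k + (1 - c) = 1 + (a + M) - c + k := by ring
    have e2 : a + M + k + (1 - d) = 1 + (a + M) - d + k := by ring
    rw [e1, e2]
    ring

theorem tsum_normalized_tendsto_one {a c d : ℝ} (h : 2 + 2 * |c| + 2 * |d| ≤ a) :
    Tendsto (fun M : ℕ => ∑' k : ℕ, (a + M + 2 * k) / (a + M) * wpTerm (a + M) c d k) atTop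
      (𝓝 1) := by
  have hc := le_abs_self c
  have hd := le_abs_self d
  have hc0 := abs_nonneg c
  have hd0 := abs_nonneg d
  have ha : a ≠ 0 := by linarith
  have hA (k : ℕ) : 1 + a - c ≠ -(k : ℝ) := by
    have : (0 : ℝ) ≤ k := k.cast_nonneg
    linarith
  have hB (k : ℕ) : 1 + a - d ≠ -(k : ℝ) := by
    have : (0 : ℝ) ≤ k := k.cast_nonneg
    linarith
  have hs : Summable fun k : ℕ => |(a + 2 * k) / a * wpTerm a c d k| := by
    refine (((summable_wpTerm hA hB (by linarith)).mul_left a⁻¹).congr fun k => ?_).abs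
    ring
  have key := tendsto_tsum_of_dominated_convergence (𝓕 := atTop)
    (f := fun (M k : ℕ) => (a + M + 2 * k) / (a + M) * wpTerm (a + M) c d k)
    (g := fun k : ℕ => if k = 0 then (1 : ℝ) else 0) hs ?_ ?_
  · simpa using key
  · intro k
    have h1 : Tendsto (fun M : ℕ => (a + (M : ℝ))⁻¹) atTop (𝓝 0) :=
      tendsto_inv_atTop_zero.comp (tendsto_atTop_add_const_left _ _ tendsto_natCast_atTop_atTop)
    have h2 := ((h1.const_mul (2 * (k : ℝ))).const_add 1).mul
      (wpTerm_tendsto_of_add_natCast hA hB k)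
    simp only [mul_zero, add_zero, one_mul] at h2
    refine h2.congr fun M => ?_
    have hM : (0 : ℝ) ≤ M := M.cast_nonneg
    have : a + (M : ℝ) ≠ 0 := by linarith
    field_simp
  · exact Eventually.of_forall fun M k => normalized_wpTerm_abs_le h k M

/-- The powers of `M` in the Pochhammer quotient leave `M⁻¹`, which the normalizing factor `a + M`
cancels. -/
theorem poch_quotient_tendsto {a c d : ℝ} (hA : ∀ k : ℕ, 1 + a - c ≠ -(k : ℝ))
    (hB : ∀ k : ℕ, 1 + a - d ≠ -(k : ℝ)) :
    Tendsto (fun M : ℕ => poch a M * poch (1 + a - c - d) M /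
        (poch (1 + a - c) M * poch (1 + a - d) M) * (a + M)) atTop
      (𝓝 (Real.Gamma (1 + a - c) * Real.Gamma (1 + a - d) * (Real.Gamma a)⁻¹ *
        (Real.Gamma (1 + a - c - d))⁻¹)) := by
  have hA' := (poch_div_tendsto (1 + a - c)).inv₀ (inv_ne_zero (Real.Gamma_ne_zero hA))
  have hB' := (poch_div_tendsto (1 + a - d)).inv₀ (inv_ne_zero (Real.Gamma_ne_zero hB))
  rw [inv_inv] at hA' hB'
  have h0 : Tendsto (fun M : ℕ => 1 + a * (M : ℝ)⁻¹) atTop (𝓝 1) := by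
    simpa using ((tendsto_inv_atTop_zero.comp
      (tendsto_natCast_atTop_atTop (R := ℝ))).const_mul a).const_add 1
  have h := ((((hA'.mul hB').mul (poch_div_tendsto a)).mul
    (poch_div_tendsto (1 + a - c - d))).mul h0)
  rw [mul_one] at h
  refine h.congr' ?_
  filter_upwards [eventually_gt_atTop 0] with k hk
  have hk' : (0 : ℝ) < k := by exact_mod_cast hk
  have h1 := poch_ne_zero hA k
  have h2 := poch_ne_zero hB k
  have h5 : (k.factorial : ℝ) ≠ 0 := by positivity
  have e : (k : ℝ) ^ (1 + a - c - 1) * (k : ℝ) ^ (1 + a - d - 1) =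
      (k : ℝ) ^ (a - 1) * (k : ℝ) ^ (1 + a - c - d - 1) * k := by
    rw [← Real.rpow_add hk', ← Real.rpow_add hk', ← Real.rpow_add_one hk'.ne']
    congr 1; ring
  have q2 := (Real.rpow_pos_of_pos hk' (a - 1)).ne'
  have q3 := (Real.rpow_pos_of_pos hk' (1 + a - c - d - 1)).ne'
  have q4 := (Real.rpow_pos_of_pos hk' (1 + a - c - 1)).ne'
  have q5 := (Real.rpow_pos_of_pos hk' (1 + a - d - 1)).ne'
  generalize (k : ℝ) ^ (a - 1) = x2 at *
  generalize (k : ℝ) ^ (1 + a - c - d - 1) = x3 at *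
  generalize (k : ℝ) ^ (1 + a - c - 1) = x4 at *
  generalize (k : ℝ) ^ (1 + a - d - 1) = x5 at *
  field_simp
  rw [e]
  field_simp
  ring

/-! ### Evaluation of the well-poised sum -/

/-- The value of the well-poised sum at `-1`, as a limit of partial sums. -/
def WpSum (a c d : ℝ) : Prop :=
  Tendsto (fun N : ℕ => ∑ k ∈ Finset.range N, (a + 2 * k) * wpTerm a c d k) atTop
    (𝓝 (Real.Gamma (1 + a - c) * Real.Gamma (1 + a - d) * (Real.Gamma a)⁻¹ *
      (Real.Gamma (1 + a - c - d))⁻¹))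

theorem wpSum_of_large {a c d : ℝ} (h : 2 + 2 * |c| + 2 * |d| ≤ a) : WpSum a c d := by
  have hc := le_abs_self c
  have hd := le_abs_self d
  have hc0 := abs_nonneg c
  have hd0 := abs_nonneg d
  have hA (M k : ℕ) : 1 + (a + M) - c ≠ -(k : ℝ) := by
    have : (0 : ℝ) ≤ k := k.cast_nonneg
    have : (0 : ℝ) ≤ M := M.cast_nonneg
    linarith
  have hB (M k : ℕ) : 1 + (a + M) - d ≠ -(k : ℝ) := by
    have : (0 : ℝ) ≤ k := k.cast_nonneg
    have : (0 : ℝ) ≤ M := M.cast_nonneg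
    linarith
  set T : ℕ → ℝ := fun M => ∑' k : ℕ, (a + M + 2 * k) * wpTerm (a + M) c d k with hT
  have hsum (M : ℕ) : Tendsto (fun N : ℕ => ∑ k ∈ Finset.range N,
      (a + M + 2 * k) * wpTerm (a + M) c d k) atTop (𝓝 (T M)) := by
    have : (0 : ℝ) ≤ M := M.cast_nonneg
    exact (summable_wpTerm (hA M) (hB M) (by linarith)).hasSum.tendsto_sum_nat
  have hstep (M : ℕ) : T M = (a + M) * (1 + (a + M) - c - d) /
      ((1 + (a + M) - c) * (1 + (a + M) - d)) * T (M + 1) := by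
    have : (0 : ℝ) ≤ M := M.cast_nonneg
    refine tendsto_nhds_unique (hsum M) ?_
    have h1 := ((hsum (M + 1)).const_mul ((a + M) * (1 + (a + M) - c - d) /
      ((1 + (a + M) - c) * (1 + (a + M) - d)))).sub
      (natCast_mul_wpTerm_tendsto (hA M) (hB M) (by linarith))
    rw [sub_zero] at h1
    refine h1.congr fun N => ?_
    rw [sum_wpTerm (hA M) (hB M)]
    push_cast
    simp only [← add_assoc]
  have hA0 (k : ℕ) : 1 + a - c ≠ -(k : ℝ) := by simpa using hA 0 k
  have hB0 (k : ℕ) : 1 + a - d ≠ -(k : ℝ) := by simpa using hB 0 k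
  have hiter (M : ℕ) : T 0 = poch a M * poch (1 + a - c - d) M /
      (poch (1 + a - c) M * poch (1 + a - d) M) * T M := by
    induction M with
    | zero => simp [poch_zero]
    | succ M ih =>
      have n1 := poch_ne_zero hA0 M
      have n2 := poch_ne_zero hB0 M
      have n3 : 1 + a - c + M ≠ 0 := fun h => hA0 M (by linarith)
      have n4 : 1 + a - d + M ≠ 0 := fun h => hB0 M (by linarith)
      have e1 : 1 + (a + M) - c = 1 + a - c + M := by ring
      have e2 : 1 + (a + M) - d = 1 + a - d + M := by ring
      rw [ih, hstep, e1, e2]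
      simp only [poch_succ]
      field_simp
      ring
  have hlim := (poch_quotient_tendsto hA0 hB0).mul (tsum_normalized_tendsto_one h)
  rw [mul_one] at hlim
  have hT0 : T 0 = Real.Gamma (1 + a - c) * Real.Gamma (1 + a - d) * (Real.Gamma a)⁻¹ *
      (Real.Gamma (1 + a - c - d))⁻¹ := by
    refine tendsto_nhds_unique tendsto_const_nhds (hlim.congr fun M => ?_)
    have : (0 : ℝ) ≤ M := M.cast_nonneg
    have hx : a + M ≠ 0 := by linarith
    rw [hiter M, mul_assoc, ← tsum_mul_left]
    congr 1
    refine tsum_congr fun k => ?_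
    field_simp
  have := hsum 0
  rw [hT0] at this
  simpa [WpSum] using this

theorem WpSum.of_add_one {a c d : ℝ} (hA : ∀ k : ℕ, 1 + a - c ≠ -(k : ℝ))
    (hB : ∀ k : ℕ, 1 + a - d ≠ -(k : ℝ))
    (hg : Tendsto (fun k : ℕ => (k : ℝ) * wpTerm a c d k) atTop (𝓝 0))
    (h : WpSum (a + 1) c d) : WpSum a c d := by
  have h1 := (Tendsto.const_mul (a * (1 + a - c - d) / ((1 + a - c) * (1 + a - d))) h).sub hg
  rw [sub_zero] at h1
  have h6 : 1 + a - c ≠ 0 := fun h => hA 0 (by simpa using h)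
  have h7 : 1 + a - d ≠ 0 := fun h => hB 0 (by simpa using h)
  have e1 : 1 + (a + 1) - c = 1 + a - c + 1 := by ring
  have e2 : 1 + (a + 1) - d = 1 + a - d + 1 := by ring
  have e3 : 1 + (a + 1) - c - d = 1 + a - c - d + 1 := by ring
  rw [e3, e1, e2, Real.Gamma_add_one h6, Real.Gamma_add_one h7] at h1
  -- Reciprocal Gammas keep the recurrence valid when `a` or `1 + a - c - d` is zero.
  rw [WpSum, inv_Gamma_eq a, inv_Gamma_eq (1 + a - c - d)]
  convert h1 using 2 with N
  · exact sum_wpTerm hA hB N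
  · field_simp

theorem wpSum_of_tendsto {a c d : ℝ} (hA : ∀ k : ℕ, 1 + a - c ≠ -(k : ℝ))
    (hB : ∀ k : ℕ, 1 + a - d ≠ -(k : ℝ))
    (hg : ∀ M : ℕ, Tendsto (fun k : ℕ => (k : ℝ) * wpTerm (a + M) c d k) atTop (𝓝 0)) :
    WpSum a c d := by
  obtain ⟨M, hM⟩ := exists_nat_ge (2 + 2 * |c| + 2 * |d| - a)
  have key (j : ℕ) (hj : j ≤ M) : WpSum (a + j) c d := by
    induction hj using Nat.decreasingInduction with
    | self => exact wpSum_of_large (by linarith)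
    | of_succ j hj ih =>
      refine WpSum.of_add_one (fun k h => add_natCast_ne hA j k (by linarith))
        (fun k h => add_natCast_ne hB j k (by linarith)) (hg j) ?_
      convert ih using 1
      push_cast
      ring
  simpa using key 0 M.zero_le

theorem natCast_mul_wpTerm_tendsto_of_terminating {a c d : ℝ} {m : ℕ}
    (h : a = -(m : ℝ) ∨ c = -(m : ℝ) ∨ d = -(m : ℝ)) :
    Tendsto (fun k : ℕ => (k : ℝ) * wpTerm a c d k) atTop (𝓝 0) := by
  refine tendsto_const_nhds.congr' ?_
  filter_upwards [eventually_gt_atTop m] with k hk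
  have := poch_neg_natCast_eq_zero hk
  rcases h with rfl | rfl | rfl <;> simp [wpTerm, this]

theorem wpSum_zero (c d : ℝ) : WpSum 0 c d := by
  have h : ∀ k : ℕ, ((0 : ℝ) + 2 * k) * wpTerm 0 c d k = 0 := by
    intro k
    rcases Nat.eq_zero_or_pos k with rfl | hk
    · simp
    · have := poch_neg_natCast_eq_zero hk
      simp only [Nat.cast_zero, neg_zero] at this
      simp [wpTerm, this]
  simp only [WpSum, h]
  simp [Real.Gamma_zero]

/-- Beyond `a = 0` the series need no longer terminate and the boundary terms need not vanish, so
the descent starts at `0`, where all terms and the value are zero. -/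
theorem wpSum_neg_natCast (m : ℕ) {c d : ℝ} (hA : ∀ k : ℕ, 1 + -(m : ℝ) - c ≠ -(k : ℝ))
    (hB : ∀ k : ℕ, 1 + -(m : ℝ) - d ≠ -(k : ℝ)) : WpSum (-(m : ℝ)) c d := by
  induction m with
  | zero => simpa using wpSum_zero c d
  | succ m ih =>
    refine WpSum.of_add_one hA hB
      (natCast_mul_wpTerm_tendsto_of_terminating (m := m + 1) (Or.inl rfl)) ?_
    have e : -((m + 1 : ℕ) : ℝ) + 1 = -(m : ℝ) := by push_cast; ring
    rw [e]
    refine ih (fun k h => add_natCast_ne hA 1 k ?_) (fun k h => add_natCast_ne hB 1 k ?_) <;>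
    · push_cast
      linarith

/-- The sum of the well-poised series with argument `-1`, under the conditions for its
convergence or termination. -/
theorem wpSum {a c d : ℝ} (hA : ∀ k : ℕ, 1 + a - c ≠ -(k : ℝ))
    (hB : ∀ k : ℕ, 1 + a - d ≠ -(k : ℝ))
    (h : 2 * c + 2 * d < a + 2 ∨ ∃ m : ℕ, c = -(m : ℝ) ∨ a = -(m : ℝ) ∨ d = -(m : ℝ)) :
    WpSum a c d := by
  rcases h with h | ⟨m, h | rfl | h⟩
  · refine wpSum_of_tendsto hA hB fun M => natCast_mul_wpTerm_tendsto
      (fun k h => add_natCast_ne hA M k (by linarith))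
      (fun k h => add_natCast_ne hB M k (by linarith)) ?_
    have : (0 : ℝ) ≤ M := M.cast_nonneg
    linarith
  · exact wpSum_of_tendsto hA hB fun M =>
      natCast_mul_wpTerm_tendsto_of_terminating (m := m) (Or.inr (Or.inl h))
  · exact wpSum_neg_natCast m hA hB
  · exact wpSum_of_tendsto hA hB fun M =>
      natCast_mul_wpTerm_tendsto_of_terminating (m := m) (Or.inr (Or.inr h))

/-! ### Specialization to the hypergeometric series -/

theorem hypTerm_eq_wpTerm {a b n : ℝ} (ha : ∀ k : ℕ, a / 2 ≠ -(k : ℝ)) (k : ℕ) :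
    hypTerm [a, -n, a / 2 + 1, a - b + 1] [b, a / 2, 1 + a + n] (-1) k =
      a⁻¹ * ((a + 2 * k) * wpTerm a (-n) (a - b + 1) k) := by
  have ha0 : a ≠ 0 := fun h => ha 0 (by simp [h])
  have hp := poch_ne_zero ha k
  have e := mul_poch_add_one (a / 2) k
  have e' : poch (a / 2 + 1) k = poch (a / 2) k * (a⁻¹ * (a + 2 * k)) := by
    field_simp at e ⊢
    linear_combination e
  have e1 : 1 + a - -n = 1 + a + n := by ring
  have e2 : 1 + a - (a - b + 1) = b := by ring
  simp only [hypTerm, wpTerm, List.map_cons, List.map_nil, List.prod_cons, List.prod_nil, mul_one,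
    e1, e2, e']
  rw [show poch a k * (poch (-n) k * (poch (a / 2) k * (a⁻¹ * (a + 2 * k)) * poch (a - b + 1) k)) =
      poch (a / 2) k * (poch a k * poch (-n) k * poch (a - b + 1) k * (a⁻¹ * (a + 2 * k))) by ring,
    show poch b k * (poch (a / 2) k * poch (1 + a + n) k) =
      poch (a / 2) k * (poch (1 + a + n) k * poch b k) by ring, mul_div_mul_left _ _ hp]
  simp only [div_eq_mul_inv, mul_inv]
  ring

theorem theorem3 (a b n : ℝ)
    (hb : ∀ k : ℕ, b ≠ -(k : ℝ))
    (ha : ∀ k : ℕ, a / 2 ≠ -(k : ℝ))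
    (han : ∀ k : ℕ, 1 + a + n ≠ -(k : ℝ))
    (hconv : a < 2 * (b + n) ∨
      ∃ m : ℕ, n = (m : ℝ) ∨ a = -(m : ℝ) ∨ a - b + 1 = -(m : ℝ)) :
    HasHypSum [a, -n, a / 2 + 1, a - b + 1] [b, a / 2, 1 + a + n] (-1)
      (pochReal (a + 1) n / pochReal b n) := by
  have ha0 : a ≠ 0 := fun h => ha 0 (by simp [h])
  have e1 : 1 + a - -n = a + 1 + n := by ring
  have e2 : 1 + a - (a - b + 1) = b := by ring
  have e3 : a + 1 + n - (a - b + 1) = b + n := by ring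
  have key : WpSum a (-n) (a - b + 1) := by
    refine wpSum (fun k h => han k (by linarith)) (fun k h => hb k (by linarith)) ?_
    rcases hconv with h | ⟨m, h⟩
    · left
      -- For these `c`, `d`, the condition `2c + 2d < a + 2` is exactly `a < 2(b + n)`.
      linarith
    · exact Or.inr ⟨m, h.imp_left fun h => by rw [h]⟩
  have h1 := Tendsto.const_mul a⁻¹ key
  rw [e1, e2, e3, inv_Gamma_eq a] at h1
  unfold HasHypSum
  simp only [hypTerm_eq_wpTerm ha, ← Finset.mul_sum]
  convert h1 using 2
  simp only [pochReal, div_eq_mul_inv, mul_inv, inv_inv]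
  field_simp
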